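/- Let $P$ be a Borel probability measure on $\mathbb R$, let $\hat A=\{a_1,\dots,a_k\}$ be a finite set with $k\ge 1$ elements, and let $\rho:\mathbb R\times\hat A\to[0,M]$ be measurable in its first argument, $M<\infty$, with $\sup_{x\in\mathbb R}\min_{y\in\hat A}\rho(x,y)=0$. Put $r_0\equiv 0$ and $r_j(x)=\rho(x,a_j)$ for $1\le j\le k$. Suppose there is a nonempty open interval $I\subset\mathbb R$ on which $P$ has an absolutely continuous component with a density $g$ satisfying $g(x)>0$ for all $x\in I$, and on which $r_1,\dots,r_k$ are continuous. Write $D_{\max}=\min_{y\in\hat A}E_P[\rho(X,y)]$. For $D\ge 0$ let $R(D)=\inf I(X;Y)$ (in bits), the infimum being over all jointly distributed $(X,Y)$ with values in $\mathbb R\times\hat A$, $X\sim P$ and $E[\rho(X,Y)]\le D$. For a probability mass function $Q$ on $\hat A$ let $R(P,Q,D)=\inf\,[I(X;Z)+H(Q_Z\|Q)]$ over the same pairs $(X,Z)$, where $Q_Z$ is the law of $Z$ and $H(\cdot\|\cdot)$ is relative entropy in bits; let $\Lambda_{P,Q}(\lambda)=E_P\big[\log_e\sum_{j=1}^k Q(a_j)e^{\lambda\rho(X,a_j)}\big]$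 for $\lambda\le 0$ and $\Lambda^*_{P,Q}(D)=\sup_{\lambda\le 0}[\lambda D-\Lambda_{P,Q}(\lambda)]$. For $D\in(0,D_{\max})$ choose a probability mass function $Q^*$ with $R(P,Q^*,D)=R(D)$ and a $\lambda^*<0$ with $\lambda^*D-\Lambda_{P,Q^*}(\lambda^*)=\Lambda^*_{P,Q^*}(D)$, and define $$f(x)=(\log_2 e)\Big[\lambda^*D-\log_e\sum_{j=1}^k Q^*(a_j)e^{\lambda^*\rho(x,a_j)}\Big]-R(D),\qquad x\in\mathbb R.$$ Suppose that $R$ is differentiable and strictly convex on $(0,D_{\max})$, and that at least one of the following holds: (a) there are distinct points $x_0,\dots,x_k\in I$ such that $r_j(x_j)>r_j(x_i)$ for all $0\le i\ne j\le k$ with $j\ne 0$; (b) there are distinct points $x_0,\dots,x_k\in I$ such that $\sum_{j=0}^k r_j(x_j)\ne\sum_{j=0}^k r_j(x_{\pi(j)})$ for every permutation $\pi$ of $\{0,\dots,k\}$ other than the identity. Then there are at most finitely many $D\in(0,D_{\max})$ for which, for some such choice of $(Q^*,\lambda^*)$, $f(X_1)=0$ with probability one, where $X_1\sim P$. -/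

import Mathlib

open MeasureTheory

namespace LossyRedundancy

noncomputable section

/-- Joint laws of `(X, Y)` on `ℝ × {1, …, k}` such that `X` has law `P` and `E[ρ(X, Y)] ≤ D`. -/
def admissibleLaws {k : ℕ} (P : Measure ℝ) (ρ : ℝ → Fin k → ℝ) (D : ℝ) :
    Set (Measure (ℝ × Fin k)) :=
  {W | W.fst = P ∧ ∫ z, ρ z.1 z.2 ∂W ≤ D}

/-- Relative entropy in bits (`InformationTheory.klDiv` is in nats). -/
def relEntropyBits {α : Type*} [MeasurableSpace α] (μ ν : Measure α) : ENNReal :=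
  InformationTheory.klDiv μ ν / ENNReal.ofReal (Real.log 2)

/-- Mutual information in bits of the two coordinates under the joint law `W`. -/
def mutualInfoBits {k : ℕ} (W : Measure (ℝ × Fin k)) : ENNReal :=
  relEntropyBits W (W.fst.prod W.snd)

/-- `R(D) = inf I(X; Y)`, as an extended nonnegative number. -/
def rateDistortionENN {k : ℕ} (P : Measure ℝ) (ρ : ℝ → Fin k → ℝ) (D : ℝ) : ENNReal :=
  ⨅ W ∈ admissibleLaws P ρ D, mutualInfoBits W

/-- The rate-distortion function `R(D)` in bits, as a real number (under the standing assumptions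
it is finite for all `D ≥ 0`). -/
def rateDistortion {k : ℕ} (P : Measure ℝ) (ρ : ℝ → Fin k → ℝ) (D : ℝ) : ℝ :=
  (rateDistortionENN P ρ D).toReal

/-- `R(P, Q, D) = inf [I(X; Z) + H(Q_Z ‖ Q)]`, which may be infinite. -/
def rateGiven {k : ℕ} (P : Measure ℝ) (ρ : ℝ → Fin k → ℝ) (Q : ProbabilityMeasure (Fin k))
    (D : ℝ) : ENNReal :=
  ⨅ W ∈ admissibleLaws P ρ D,
    (mutualInfoBits W + relEntropyBits W.snd (Q : Measure (Fin k)))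

/-- `D_max = min_y E_P[ρ(X, y)]`. -/
def distMax {k : ℕ} (P : Measure ℝ) (ρ : ℝ → Fin k → ℝ) : ℝ :=
  ⨅ j : Fin k, ∫ x, ρ x j ∂P

/-- `Λ_{P,Q}(lam) = E_P[log_e E_Q(exp(lam ρ(X, Y)))]`. -/
def logMGF {k : ℕ} (P : Measure ℝ) (ρ : ℝ → Fin k → ℝ) (Q : ProbabilityMeasure (Fin k))
    (lam : ℝ) : ℝ :=
  ∫ x, Real.log (∫ j, Real.exp (lam * ρ x j) ∂(Q : Measure (Fin k))) ∂P

/-- The Fenchel-Legendre transform `Λ*_{P,Q}(D) = sup_{lam ≤ 0} [lam D - Λ_{P,Q}(lam)]`,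
possibly infinite. -/
def logMGFStar {k : ℕ} (P : Measure ℝ) (ρ : ℝ → Fin k → ℝ) (Q : ProbabilityMeasure (Fin k))
    (D : ℝ) : EReal :=
  ⨆ (lam : ℝ) (_ : lam ≤ 0), ((lam * D - logMGF P ρ Q lam : ℝ) : EReal)

/-- `(Q, lam)` is an admissible choice of `(Q*, λ*)` at distortion level `D`: `Q` achieves
`R(D) = inf_Q R(P, Q, D)`, and `lam < 0` attains the supremum that defines `Λ*_{P,Q}(D)`. -/
structure IsOptimalPair {k : ℕ} (P : Measure ℝ) (ρ : ℝ → Fin k → ℝ) (D : ℝ)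
    (Q : ProbabilityMeasure (Fin k)) (lam : ℝ) : Prop where
  rate_eq : rateGiven P ρ Q D = rateDistortionENN P ρ D
  neg : lam < 0
  attains : ((lam * D - logMGF P ρ Q lam : ℝ) : EReal) = logMGFStar P ρ Q D

/-- The function
`f(x) = (log₂ e) [lam D - log_e E_Q(exp(lam ρ(x, Y)))] - R(D)` for the choice `(Q, lam)`. -/
def redundancyFn {k : ℕ} (P : Measure ℝ) (ρ : ℝ → Fin k → ℝ) (D : ℝ)
    (Q : ProbabilityMeasure (Fin k)) (lam : ℝ) (x : ℝ) : ℝ :=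
  Real.logb 2 (Real.exp 1) *
      (lam * D - Real.log (∫ j, Real.exp (lam * ρ x j) ∂(Q : Measure (Fin k))))
    - rateDistortion P ρ D

/-- On `I`, the absolutely continuous component of `P` (in its Lebesgue decomposition) has a
density that is positive on `I`. -/
def HasPositiveDensityOn (P : Measure ℝ) (I : Set ℝ) : Prop :=
  ∃ (g : ℝ → ENNReal) (ν : Measure ℝ), Measurable g ∧ (∀ x ∈ I, 0 < g x) ∧
    ν.MutuallySingular volume ∧ P.restrict I = (volume.restrict I).withDensity g + ν

/-- The functions `r_0 = 0` and `r_j = ρ(·, a_j)` for `1 ≤ j ≤ k`. -/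
def distFn {k : ℕ} (ρ : ℝ → Fin k → ℝ) (j : Fin (k + 1)) (x : ℝ) : ℝ :=
  Fin.cases (motive := fun _ => ℝ) 0 (fun i => ρ x i) j

/-- Condition (a): distinct points `x_0, …, x_k` of `I` with `r_j(x_j) > r_j(x_i)` for all
`i ≠ j` with `j ≠ 0`. -/
def ConditionA {k : ℕ} (ρ : ℝ → Fin k → ℝ) (I : Set ℝ) : Prop :=
  ∃ x : Fin (k + 1) → ℝ, Function.Injective x ∧ (∀ i, x i ∈ I) ∧
    ∀ i j, i ≠ j → j ≠ 0 → distFn ρ j (x j) > distFn ρ j (x i)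

/-- Condition (b): distinct points `x_0, …, x_k` of `I` with
`∑ r_j(x_j) ≠ ∑ r_j(x_{π(j)})` for every permutation `π` other than the identity. -/
def ConditionB {k : ℕ} (ρ : ℝ → Fin k → ℝ) (I : Set ℝ) : Prop :=
  ∃ x : Fin (k + 1) → ℝ, Function.Injective x ∧ (∀ i, x i ∈ I) ∧
    ∀ π : Equiv.Perm (Fin (k + 1)), π ≠ 1 →
      ∑ j, distFn ρ j (x j) ≠ ∑ j, distFn ρ j (x (π j))

end

end LossyRedundancy

/-!
Suppose that `f = 0` almost surely at the level `D` for a choice `(Q, lam)`. Then the partition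
function `x ↦ E_Q[exp (lam ρ(x, Y))]` is `P`-almost surely constant, hence constant on `I`, where it
is continuous and `P` has a positive density component. Evaluated at the points `x_0, …, x_k`, this
says that the columns of the matrix `exp (lam r_j(x_i))` are linearly dependent
(`det_exp_eq_zero`). By the Leibniz formula the determinant is an exponential sum in `lam` with
exponents `∑ r_j(x_{π(j)})`. Condition (b), which follows from (a), says that the exponent of the
identity permutation is not cancelled by any other, so the sum has finitely many real zeros, by
Rolle's theorem (`finite_zeros_det_exp`).

It remains to recover `D` from `lam`, and `lam = R'(D) log 2` does this, since `R'` is injective by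
strict convexity (`deriv_mul_log_two_eq`). This needs neither the minimax theorem nor the identity
`R(P, Q, D) = Λ*_{P,Q}(D)`: as `f = 0`, the test channel with density
`exp (lam ρ(x, y)) / E_Q[exp (lam ρ(x, Y))]` has distortion `D` and rate at most `R(D)`, and an
explicit linear perturbation of it bounds `R` near `D` from above by a parabola that touches `R` at
`D` with slope `lam` (in nats). The parabola degenerates only if the distortion is a function of
`x` alone on the support of `Q`, which would give `D_max ≤ D`.
-/

namespace LossyRedundancy

/-! ### Zeros of real exponential sums -/

/-- By Rolle's theorem, a function has at most one more zero than its derivative. -/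
theorem finite_zeros_of_finite_zeros_hasDerivAt {f f' : ℝ → ℝ} (hf : ∀ x, HasDerivAt f (f' x) x)
    (h : {x | f' x = 0}.Finite) : {x | f x = 0}.Finite := by
  refine Set.Finite.of_injOn (f := fun x => (h.toFinset.filter (· < x)).card)
    (t := (Finset.range (h.toFinset.card + 1) : Set ℕ)) ?_ ?_ (Finset.finite_toSet _)
  · intro x _
    simpa [Nat.lt_succ_iff] using Finset.card_filter_le h.toFinset (· < x)
  · -- A zero of `f'` lies strictly between two zeros of `f`, so the count is strictly increasing.
    have key : ∀ x y, f x = 0 → f y = 0 → x < y →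
        (h.toFinset.filter (· < x)).card < (h.toFinset.filter (· < y)).card := by
      intro x y hx hy hxy
      obtain ⟨c, hc, hc0⟩ := exists_hasDerivAt_eq_zero hxy
        (fun z _ => (hf z).continuousAt.continuousWithinAt) (hx.trans hy.symm)
        (fun z _ => hf z)
      refine Finset.card_lt_card ⟨fun z hz => ?_, fun hsub => ?_⟩
      · simp only [Finset.mem_filter] at hz ⊢
        exact ⟨hz.1, hz.2.trans hxy⟩
      · have : c ∈ h.toFinset.filter (· < x) := hsub (by simp [hc0, hc.2])
        exact lt_asymm hc.1 (Finset.mem_filter.1 this).2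
    intro x hx y hy hxy
    rcases lt_trichotomy x y with hlt | heq | hlt
    · exact absurd hxy (key x y hx hy hlt).ne
    · exact heq
    · exact absurd hxy (key y x hy hx hlt).ne'

/-- An exponential sum in which some exponent occurs exactly once, with a nonzero coefficient, has
only finitely many real zeros. The other exponents may coincide. -/
theorem finite_zeros_sum_mul_exp {ι : Type*} [DecidableEq ι] (s : Finset ι) (i₀ : ι) (a b : ι → ℝ)
    (hi₀ : i₀ ∈ s) (ha : a i₀ ≠ 0) (hb : ∀ i ∈ s, i ≠ i₀ → b i ≠ b i₀) :
    {t : ℝ | ∑ i ∈ s, a i * Real.exp (t * b i) = 0}.Finite := by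
  induction s using Finset.strongInduction generalizing a b with
  | H s ih =>
    by_cases hs : ∃ i₁ ∈ s, i₁ ≠ i₀
    · obtain ⟨i₁, hi₁, hne⟩ := hs
      -- Dividing by `exp (t * b i₁)` makes the term `i₁` constant; differentiating removes it.
      have hfin := ih (s.erase i₁) (Finset.erase_ssubset hi₁)
        (fun i => a i * (b i - b i₁)) (fun i => b i - b i₁)
        (Finset.mem_erase.2 ⟨hne.symm, hi₀⟩)
        (mul_ne_zero ha (sub_ne_zero.2 (hb i₁ hi₁ hne).symm))
        (fun i hi hi' => by
          have := hb i (Finset.mem_of_mem_erase hi) hi'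
          simpa using this)
      have hderiv : ∀ t : ℝ, HasDerivAt (fun t => ∑ i ∈ s, a i * Real.exp (t * (b i - b i₁)))
          (∑ i ∈ s.erase i₁, a i * (b i - b i₁) * Real.exp (t * (b i - b i₁))) t := by
        intro t
        have hsum : HasDerivAt (fun t => ∑ i ∈ s, a i * Real.exp (t * (b i - b i₁)))
            (∑ i ∈ s, a i * (Real.exp (t * (b i - b i₁)) * (b i - b i₁))) t := by
          refine HasDerivAt.fun_sum fun i _ => ?_
          exact (((hasDerivAt_id t).mul_const (b i - b i₁)).exp.const_mul (a i)).congr_deriv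
            (by simp)
        refine hsum.congr_deriv ?_
        rw [← Finset.add_sum_erase s _ hi₁]
        simp only [sub_self, mul_zero, zero_add]
        exact Finset.sum_congr rfl fun i _ => by ring
      refine (finite_zeros_of_finite_zeros_hasDerivAt hderiv hfin).subset fun t ht => ?_
      have : ∑ i ∈ s, a i * Real.exp (t * (b i - b i₁))
          = (∑ i ∈ s, a i * Real.exp (t * b i)) * Real.exp (-(t * b i₁)) := by
        rw [Finset.sum_mul]
        refine Finset.sum_congr rfl fun i _ => ?_
        rw [mul_assoc, ← Real.exp_add]
        ring_nf
      simp only [Set.mem_ofPred_eq] at ht ⊢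
      rw [this, ht, zero_mul]
    · push Not at hs
      have hs' : s = {i₀} := Finset.eq_singleton_iff_unique_mem.2 ⟨hi₀, hs⟩
      subst hs'
      simp [ha, Real.exp_ne_zero]

/-! ### The exponential determinant -/

/-- Under condition (a) the identity is the strict maximizer of `π ↦ ∑ r_j(x_{π(j)})`. -/
theorem ConditionA.conditionB {k : ℕ} {ρ : ℝ → Fin k → ℝ} {I : Set ℝ} (h : ConditionA ρ I) :
    ConditionB ρ I := by
  obtain ⟨x, hx, hxI, hlt⟩ := h
  refine ⟨x, hx, hxI, fun π hπ => (Finset.sum_lt_sum (fun j _ => ?_) ?_).ne'⟩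
  · by_cases hj : π j = j
    · rw [hj]
    · by_cases h0 : j = 0
      · subst h0
        exact le_rfl
      · exact (hlt (π j) j hj h0).le
  · by_contra! hcon
    -- `π` fixes every `j ≠ 0`, hence also `0`.
    have hfix : ∀ j, j ≠ 0 → π j = j := fun j h0 => by
      by_contra hj
      exact absurd (hlt (π j) j hj h0) (not_lt.2 (hcon j (Finset.mem_univ _)))
    refine hπ (Equiv.ext fun j => ?_)
    by_cases h0 : j = 0
    · subst h0
      by_contra hj
      exact hj (π.injective (hfix _ hj))
    · exact hfix j h0

/-- The determinant of the matrix `exp (t * r_j(x_i))` vanishes for only finitely many `t`. -/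
theorem finite_zeros_det_exp {k : ℕ} {ρ : ℝ → Fin k → ℝ} {x : Fin (k + 1) → ℝ}
    (hx : ∀ π : Equiv.Perm (Fin (k + 1)), π ≠ 1 →
      ∑ j, distFn ρ j (x j) ≠ ∑ j, distFn ρ j (x (π j))) :
    {t : ℝ | (Matrix.of fun i j => Real.exp (t * distFn ρ j (x i))).det = 0}.Finite := by
  have := finite_zeros_sum_mul_exp (Finset.univ : Finset (Equiv.Perm (Fin (k + 1)))) 1
    (fun π => ((Equiv.Perm.sign π : ℤ) : ℝ)) (fun π => ∑ j, distFn ρ j (x (π j)))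
    (Finset.mem_univ _) (by simp) (fun π _ hπ => by simpa using (hx π hπ).symm)
  refine this.subset fun t ht => ?_
  simp only [Set.mem_ofPred_eq, Matrix.det_apply', Matrix.of_apply] at ht ⊢
  rw [← ht]
  refine Finset.sum_congr rfl fun π _ => ?_
  rw [← Real.exp_sum, Finset.mul_sum]

/-- If the `Q`-average of `exp (t * ρ(x_i, ·))` is the same at all the points `x_i`, then the
columns of the matrix `exp (t * r_j(x_i))` are linearly dependent: the column `j = 0` is
constantly `1`. -/
theorem det_exp_eq_zero {k : ℕ} {ρ : ℝ → Fin k → ℝ} (Q : ProbabilityMeasure (Fin k))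
    {x : Fin (k + 1) → ℝ} {t c : ℝ}
    (h : ∀ i, ∫ j, Real.exp (t * ρ (x i) j) ∂(Q : Measure (Fin k)) = c) :
    (Matrix.of fun i j => Real.exp (t * distFn ρ j (x i))).det = 0 := by
  refine Matrix.exists_mulVec_eq_zero_iff.1
    ⟨Fin.cons (-c) fun j => (Q : Measure (Fin k)).real {j}, fun h0 => ?_, funext fun i => ?_⟩
  · have hQ : ∑ j, (Q : Measure (Fin k)).real {j} = 1 := by
      rw [sum_measureReal_singleton]
      simp
    have hz : ∀ j, (Q : Measure (Fin k)).real {j} = 0 := fun j => by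
      simpa using congrFun h0 j.succ
    simp [hz] at hQ
  · have := h i
    rw [integral_fintype Integrable.of_finite] at this
    simp only [Matrix.mulVec, dotProduct, Matrix.of_apply, Fin.sum_univ_succ, Fin.cons_zero,
      Fin.cons_succ, Pi.zero_apply]
    simp only [smul_eq_mul] at this
    have e0 : distFn ρ 0 (x i) = 0 := rfl
    have e1 : ∀ j : Fin k, distFn ρ j.succ (x i) = ρ (x i) j := fun j => rfl
    simp only [e0, e1, mul_zero, Real.exp_zero, one_mul, ← this]
    rw [neg_add_eq_zero]
    exact Finset.sum_congr rfl fun j _ => mul_comm _ _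

/-! ### From almost everywhere to everywhere -/

/-- Where `P` has a positive density component, a `P`-almost sure property holds Lebesgue-almost
everywhere. -/
theorem HasPositiveDensityOn.ae_volume {P : Measure ℝ} {I : Set ℝ} (hP : HasPositiveDensityOn P I)
    (hI : MeasurableSet I) {p : ℝ → Prop} (h : ∀ᵐ x ∂P, p x) : ∀ᵐ x ∂volume.restrict I, p x := by
  obtain ⟨g, ν, hg, hpos, -, heq⟩ := hP
  have h1 : ∀ᵐ x ∂(volume.restrict I).withDensity g, p x :=
    (Measure.absolutelyContinuous_of_le (heq ▸ Measure.le_add_right le_rfl)).ae_le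
      (ae_restrict_of_ae h)
  rw [ae_withDensity_iff hg] at h1
  filter_upwards [h1, ae_restrict_mem hI] with x hx hxI
  exact hx (hpos x hxI).ne'

/-! ### Bounded measurable functions -/

/-- A real function that is measurable and bounded, hence integrable for every finite measure. -/
def BddMeasurable {α : Type*} [MeasurableSpace α] (f : α → ℝ) : Prop :=
  Measurable f ∧ ∃ C, ∀ z, |f z| ≤ C

namespace BddMeasurable

variable {α β : Type*} [MeasurableSpace α] [MeasurableSpace β] {f g : α → ℝ}

theorem integrable (hf : BddMeasurable f) (μ : Measure α) [IsFiniteMeasure μ] :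
    Integrable f μ := by
  obtain ⟨hm, C, hC⟩ := hf
  exact Integrable.of_bound hm.aestronglyMeasurable C (ae_of_all _ hC)

theorem const (c : ℝ) : BddMeasurable (fun _ : α => c) := ⟨measurable_const, |c|, fun _ => le_rfl⟩

theorem add (hf : BddMeasurable f) (hg : BddMeasurable g) : BddMeasurable fun z => f z + g z := by
  obtain ⟨hf, C, hC⟩ := hf
  obtain ⟨hg, C', hC'⟩ := hg
  exact ⟨hf.add hg, C + C', fun z => (abs_add_le _ _).trans (add_le_add (hC z) (hC' z))⟩

theorem mul (hf : BddMeasurable f) (hg : BddMeasurable g) : BddMeasurable fun z => f z * g z := by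
  obtain ⟨hf, C, hC⟩ := hf
  obtain ⟨hg, C', hC'⟩ := hg
  refine ⟨hf.mul hg, C * C', fun z => ?_⟩
  rw [abs_mul]
  exact mul_le_mul (hC z) (hC' z) (abs_nonneg _) ((abs_nonneg _).trans (hC z))

theorem sub (hf : BddMeasurable f) (hg : BddMeasurable g) : BddMeasurable fun z => f z - g z := by
  simpa [sub_eq_add_neg] using hf.add ((const (-1)).mul hg)

theorem comp (hf : BddMeasurable f) {φ : β → α} (hφ : Measurable φ) :
    BddMeasurable fun z => f (φ z) := by
  obtain ⟨hf, C, hC⟩ := hf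
  exact ⟨hf.comp hφ, C, fun z => hC _⟩

theorem of_mem_Icc (hf : Measurable f) {a C : ℝ} (h : ∀ z, f z ∈ Set.Icc a C) :
    BddMeasurable f :=
  ⟨hf, max |a| |C|, fun z => abs_le_max_abs_abs (h z).1 (h z).2⟩

theorem log (hf : Measurable f) {a C : ℝ} (ha : 0 < a) (h : ∀ z, f z ∈ Set.Icc a C) :
    BddMeasurable fun z => Real.log (f z) :=
  of_mem_Icc hf.log fun z =>
    ⟨Real.log_le_log ha (h z).1, Real.log_le_log (ha.trans_le (h z).1) (h z).2⟩

theorem exp (hf : BddMeasurable f) : BddMeasurable fun z => Real.exp (f z) := by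
  obtain ⟨hf, C, hC⟩ := hf
  refine ⟨hf.exp, Real.exp C, fun z => ?_⟩
  rw [Real.abs_exp]
  exact Real.exp_le_exp.2 ((le_abs_self _).trans (hC z))

theorem integral_right {f : α × β → ℝ} (hf : BddMeasurable f) (ν : Measure β)
    [IsProbabilityMeasure ν] : BddMeasurable fun x => ∫ y, f (x, y) ∂ν := by
  obtain ⟨hf, C, hC⟩ := hf
  refine ⟨(hf.stronglyMeasurable.integral_prod_right').measurable, C, fun x => ?_⟩
  have h := norm_integral_le_of_norm_le_const (μ := ν) (f := fun y => f (x, y)) (C := C)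
    (ae_of_all _ fun y => hC (x, y))
  simpa using h

end BddMeasurable

/-! ### An upper bound on the rate-distortion function -/

/-- A test channel with density `w` with respect to `P × Q` bounds the rate-distortion function (in
nats) by its relative entropy to `P × Q`: the mutual information is the relative entropy to the
product of the marginals, which replaces `Q` by the best output law. -/
theorem rateDistortion_mul_log_two_le {k : ℕ} {P : Measure ℝ} [IsProbabilityMeasure P]
    {ρ : ℝ → Fin k → ℝ} {Q : Measure (Fin k)} [IsProbabilityMeasure Q] {D a C : ℝ}
    {w : ℝ × Fin k → ℝ} (hw : Measurable w) (ha : 0 < a) (hwb : ∀ z, w z ∈ Set.Icc a C)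
    (hnorm : ∀ x, ∫ j, w (x, j) ∂Q = 1) (hD : ∫ z, w z * ρ z.1 z.2 ∂(P.prod Q) ≤ D) :
    rateDistortion P ρ D * Real.log 2 ≤ ∫ z, w z * Real.log (w z) ∂(P.prod Q) := by
  have hpos : ∀ z, 0 < w z := fun z => ha.trans_le (hwb z).1
  have hwB : BddMeasurable w := .of_mem_Icc hw hwb
  set μ := P.prod Q with hμ
  set W : Measure (ℝ × Fin k) := μ.withDensity fun z => ENNReal.ofReal (w z) with hWdef
  have hwm : Measurable fun z => ENNReal.ofReal (w z) := hw.ennreal_ofReal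
  have hfst : W.fst = P := by
    ext s hs
    rw [Measure.fst_apply hs, hWdef, withDensity_apply _ (measurable_fst hs), ← Set.prod_univ,
      hμ, ← Measure.prod_restrict, lintegral_prod _ hwm.aemeasurable]
    have : ∀ x, ∫⁻ j, ENNReal.ofReal (w (x, j)) ∂Q = 1 := fun x => by
      rw [← ofReal_integral_eq_lintegral_ofReal
        ((hwB.comp measurable_prodMk_left).integrable Q) (ae_of_all _ fun j => (hpos _).le),
        hnorm, ENNReal.ofReal_one]
    simp [this]
  have hWprob : IsProbabilityMeasure W := ⟨by rw [← Measure.fst_univ, hfst, measure_univ]⟩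
  set u : Fin k → ℝ := fun j => ∫ x, w (x, j) ∂P with hu
  have hui : ∀ j, Integrable (fun x => w (x, j)) P := fun j =>
    (hwB.comp measurable_prodMk_right).integrable P
  have hub : ∀ j, u j ∈ Set.Icc a C := fun j => by
    constructor
    · simpa using integral_mono (integrable_const a) (hui j) fun x => (hwb (x, j)).1
    · simpa using integral_mono (hui j) (integrable_const C) fun x => (hwb (x, j)).2
  have hupos : ∀ j, 0 < u j := fun j => ha.trans_le (hub j).1
  have hum : Measurable fun z : ℝ × Fin k => u z.2 := (measurable_of_finite u).comp measurable_snd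
  have hsnd : W.snd = Q.withDensity fun j => ENNReal.ofReal (u j) := by
    ext s hs
    rw [Measure.snd_apply hs, hWdef, withDensity_apply _ (measurable_snd hs), ← Set.univ_prod,
      hμ, ← Measure.prod_restrict, lintegral_prod_symm _ hwm.aemeasurable,
      withDensity_apply _ hs, Measure.restrict_univ]
    refine lintegral_congr fun j => ?_
    rw [ofReal_integral_eq_lintegral_ofReal (hui j) (ae_of_all _ fun x => (hpos _).le)]
  have hν : W.fst.prod W.snd = μ.withDensity fun z => ENNReal.ofReal (u z.2) := by
    rw [hfst, hsnd, prod_withDensity_right (measurable_of_finite _)]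
  set ν := W.fst.prod W.snd with hνdef
  have hvm : Measurable fun z : ℝ × Fin k => ENNReal.ofReal (w z / u z.2) :=
    (hw.div hum).ennreal_ofReal
  have hWν : W = ν.withDensity fun z => ENNReal.ofReal (w z / u z.2) := by
    rw [hν, ← withDensity_mul _ hum.ennreal_ofReal hvm, hWdef]
    congr 1
    funext z
    rw [Pi.mul_apply, ← ENNReal.ofReal_mul (hupos _).le, mul_div_cancel₀ _ (hupos _).ne']
  have hac : W ≪ ν := by
    rw [hWν]
    exact withDensity_absolutelyContinuous _ _
  have hllr : llr W ν =ᵐ[W] fun z => Real.log (w z / u z.2) := by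
    have h1 : W.rnDeriv ν =ᵐ[ν] fun z => ENNReal.ofReal (w z / u z.2) := by
      conv_lhs => rw [hWν]
      exact Measure.rnDeriv_withDensity ν hvm
    filter_upwards [hac.ae_le h1] with z hz
    rw [llr, hz, ENNReal.toReal_ofReal (div_pos (hpos _) (hupos _)).le]
  have hlogw : BddMeasurable fun z => Real.log (w z) := .log hw ha hwb
  have hlogu : BddMeasurable fun z : ℝ × Fin k => Real.log (u z.2) :=
    .log hum ha fun z => hub z.2
  have hlog : (fun z => Real.log (w z / u z.2)) = fun z => Real.log (w z) - Real.log (u z.2) :=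
    funext fun z => Real.log_div (hpos _).ne' (hupos _).ne'
  have hint : Integrable (llr W ν) W := by
    rw [integrable_congr hllr, hlog]
    exact (hlogw.sub hlogu).integrable W
  have hkl : (InformationTheory.klDiv W ν).toReal
      = ∫ z, w z * (Real.log (w z) - Real.log (u z.2)) ∂μ := by
    rw [InformationTheory.toReal_klDiv_of_measure_eq hac (by simp), integral_congr_ae hllr, hlog,
      hWdef, integral_withDensity_eq_integral_toReal_smul hwm (ae_of_all _ fun _ => by simp)]
    refine integral_congr_ae (ae_of_all _ fun z => ?_)
    simp only [ENNReal.toReal_ofReal (hpos z).le, smul_eq_mul]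
  -- Gibbs' inequality for the output law, through `1 - u⁻¹ ≤ log u`
  have hinvB : BddMeasurable fun z : ℝ × Fin k => (u z.2)⁻¹ :=
    .of_mem_Icc hum.inv (a := C⁻¹) (C := a⁻¹) fun z =>
      ⟨inv_anti₀ (hupos _) (hub _).2, inv_anti₀ ha (hub _).1⟩
  have h1 : ∫ z, w z ∂μ = 1 := by
    rw [hμ, integral_prod _ (hwB.integrable _)]
    simp [hnorm]
  have h2 : ∫ z, w z * (u z.2)⁻¹ ∂μ = 1 := by
    rw [hμ, integral_prod_symm _ ((hwB.mul hinvB).integrable _)]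
    have : ∀ j, ∫ x, w (x, j) * (u j)⁻¹ ∂P = 1 := fun j => by
      rw [integral_mul_const]
      exact mul_inv_cancel₀ (hupos j).ne'
    simp [this]
  have hle : (InformationTheory.klDiv W ν).toReal ≤ ∫ z, w z * Real.log (w z) ∂μ := by
    have hA := (hwB.mul hlogw).integrable μ
    have hB := (hwB.mul hinvB).integrable μ
    have hAB := ((hwB.mul hlogw).add (hwB.mul hinvB)).integrable μ
    calc (InformationTheory.klDiv W ν).toReal
        = ∫ z, w z * (Real.log (w z) - Real.log (u z.2)) ∂μ := hkl
      _ ≤ ∫ z, (w z * Real.log (w z) + w z * (u z.2)⁻¹ - w z) ∂μ := by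
          refine integral_mono ((hwB.mul (hlogw.sub hlogu)).integrable μ)
            (hAB.sub (hwB.integrable μ)) fun z => ?_
          have := mul_le_mul_of_nonneg_left (Real.one_sub_inv_le_log_of_pos (hupos z.2))
            (hpos z).le
          simp only
          linarith
      _ = ∫ z, w z * Real.log (w z) ∂μ := by
          rw [integral_sub hAB (hwB.integrable μ), integral_add hA hB, h1, h2]
          ring
  have hmem : W ∈ admissibleLaws P ρ D := by
    refine ⟨hfst, ?_⟩
    rw [hWdef, integral_withDensity_eq_integral_toReal_smul hwm (ae_of_all _ fun _ => by simp)]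
    refine le_trans (le_of_eq (integral_congr_ae (ae_of_all _ fun z => ?_))) hD
    simp only [ENNReal.toReal_ofReal (hpos z).le, smul_eq_mul]
  have hlog2 : 0 < Real.log 2 := Real.log_pos one_lt_two
  have hRle : rateDistortionENN P ρ D
      ≤ InformationTheory.klDiv W ν / ENNReal.ofReal (Real.log 2) := iInf₂_le W hmem
  have hfin : InformationTheory.klDiv W ν / ENNReal.ofReal (Real.log 2) ≠ ⊤ :=
    ENNReal.div_ne_top (InformationTheory.klDiv_ne_top hac hint)
      (ENNReal.ofReal_pos.2 hlog2).ne'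
  have := ENNReal.toReal_mono hfin hRle
  rw [ENNReal.toReal_div, ENNReal.toReal_ofReal hlog2.le, le_div_iff₀ hlog2] at this
  exact this.trans hle

/-! ### The exponentially tilted test channel -/

section Tilt

variable {k : ℕ} {P : Measure ℝ} [IsProbabilityMeasure P] {ρ : ℝ → Fin k → ℝ}
  {Q : ProbabilityMeasure (Fin k)}

/-- The partition function `x ↦ E_Q[exp (t ρ(x, Y))]`. -/
noncomputable def partitionFn (ρ : ℝ → Fin k → ℝ) (Q : ProbabilityMeasure (Fin k)) (t x : ℝ) : ℝ :=
  ∫ j, Real.exp (t * ρ x j) ∂(Q : Measure (Fin k))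

/-- The density with respect to `P × Q` of the test channel obtained by exponential tilting with
parameter `t`; it does not involve `P`. -/
noncomputable def tilt (ρ : ℝ → Fin k → ℝ) (Q : ProbabilityMeasure (Fin k)) (t : ℝ)
    (z : ℝ × Fin k) : ℝ :=
  Real.exp (t * ρ z.1 z.2) / partitionFn ρ Q t z.1

theorem measurable_partitionFn (hr : BddMeasurable fun z : ℝ × Fin k => ρ z.1 z.2) (t : ℝ) :
    Measurable (partitionFn ρ Q t) :=
  ((((BddMeasurable.const t).mul hr).exp).integral_right (Q : Measure (Fin k))).1

theorem exists_partitionFn_mem_Icc (hr : BddMeasurable fun z : ℝ × Fin k => ρ z.1 z.2) (t : ℝ) :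
    ∃ a C, 0 < a ∧ ∀ x, partitionFn ρ Q t x ∈ Set.Icc a C := by
  obtain ⟨-, M, hM⟩ := hr
  have hb : ∀ x j, |t * ρ x j| ≤ |t| * M := fun x j => by
    rw [abs_mul]
    exact mul_le_mul_of_nonneg_left (hM (x, j)) (abs_nonneg t)
  refine ⟨Real.exp (-(|t| * M)), Real.exp (|t| * M), Real.exp_pos _, fun x => ⟨?_, ?_⟩⟩
  · simpa [partitionFn] using integral_mono (μ := (Q : Measure (Fin k)))
      (integrable_const (Real.exp (-(|t| * M)))) (.of_finite (f := fun j => Real.exp (t * ρ x j)))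
      fun j => Real.exp_le_exp.2 (abs_le.1 (hb x j)).1
  · simpa [partitionFn] using integral_mono (μ := (Q : Measure (Fin k)))
      (.of_finite (f := fun j => Real.exp (t * ρ x j))) (integrable_const (Real.exp (|t| * M)))
      fun j => Real.exp_le_exp.2 (abs_le.1 (hb x j)).2

theorem partitionFn_pos (hr : BddMeasurable fun z : ℝ × Fin k => ρ z.1 z.2) (t x : ℝ) :
    0 < partitionFn ρ Q t x := by
  obtain ⟨a, C, ha, h⟩ := exists_partitionFn_mem_Icc (Q := Q) hr t
  exact ha.trans_le (h x).1

theorem bddMeasurable_log_partitionFn (hr : BddMeasurable fun z : ℝ × Fin k => ρ z.1 z.2)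
    (t : ℝ) : BddMeasurable fun x => Real.log (partitionFn ρ Q t x) := by
  obtain ⟨a, C, ha, h⟩ := exists_partitionFn_mem_Icc (Q := Q) hr t
  exact .log (measurable_partitionFn hr t) ha h

theorem tilt_eq_exp (hr : BddMeasurable fun z : ℝ × Fin k => ρ z.1 z.2) (t : ℝ)
    (z : ℝ × Fin k) :
    tilt ρ Q t z = Real.exp (t * ρ z.1 z.2 - Real.log (partitionFn ρ Q t z.1)) := by
  rw [Real.exp_sub, Real.exp_log (partitionFn_pos hr t z.1), tilt]

theorem tilt_pos (hr : BddMeasurable fun z : ℝ × Fin k => ρ z.1 z.2) (t : ℝ)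
    (z : ℝ × Fin k) : 0 < tilt ρ Q t z := by
  rw [tilt_eq_exp hr]
  exact Real.exp_pos _

theorem bddMeasurable_log_tilt (hr : BddMeasurable fun z : ℝ × Fin k => ρ z.1 z.2) (t : ℝ) :
    BddMeasurable fun z : ℝ × Fin k =>
      t * ρ z.1 z.2 - Real.log (partitionFn ρ Q t z.1) :=
  ((BddMeasurable.const t).mul hr).sub ((bddMeasurable_log_partitionFn hr t).comp measurable_fst)

theorem bddMeasurable_tilt (hr : BddMeasurable fun z : ℝ × Fin k => ρ z.1 z.2) (t : ℝ) :
    BddMeasurable (tilt ρ Q t) := by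
  simpa only [← tilt_eq_exp hr] using (bddMeasurable_log_tilt (Q := Q) hr t).exp

theorem exists_le_tilt (hr : BddMeasurable fun z : ℝ × Fin k => ρ z.1 z.2) (t : ℝ) :
    ∃ a, 0 < a ∧ ∀ z, a ≤ tilt ρ Q t z := by
  obtain ⟨-, C, hC⟩ := bddMeasurable_log_tilt (Q := Q) hr t
  refine ⟨Real.exp (-C), Real.exp_pos _, fun z => ?_⟩
  rw [tilt_eq_exp hr]
  exact Real.exp_le_exp.2 (abs_le.1 (hC z)).1

theorem integral_tilt_right (hr : BddMeasurable fun z : ℝ × Fin k => ρ z.1 z.2) (t x : ℝ) :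
    ∫ j, tilt ρ Q t (x, j) ∂(Q : Measure (Fin k)) = 1 := by
  simp only [tilt]
  rw [integral_div]
  exact div_self (partitionFn_pos hr t x).ne'

/-- If `t < 0` maximizes `s ↦ s D - Λ(s)` over `s ≤ 0`, then `D` is the distortion of the tilted
test channel, that is, `D = Λ'(t)`. -/
theorem integral_tilt_mul_eq (hr : BddMeasurable fun z : ℝ × Fin k => ρ z.1 z.2) {t D : ℝ}
    (ht : t < 0) (hmax : ∀ s ≤ 0, s * D - logMGF P ρ Q s ≤ t * D - logMGF P ρ Q t) :
    ∫ z, tilt ρ Q t z * ρ z.1 z.2 ∂(P.prod (Q : Measure (Fin k))) = D := by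
  obtain ⟨M, hM⟩ := hr.2
  have hTr := (bddMeasurable_tilt (Q := Q) hr t).mul hr
  set d := ∫ z, tilt ρ Q t z * ρ z.1 z.2 ∂(P.prod (Q : Measure (Fin k))) with hd
  -- `Λ(t + s) - Λ(t) ≤ s d + s² M²`, from `log y ≤ y - 1` and `exp y ≤ 1 + y + y²` for `|y| ≤ 1`
  have hupper : ∀ s : ℝ, |s| * M ≤ 1 →
      logMGF P ρ Q (t + s) - logMGF P ρ Q t ≤ s * d + s ^ 2 * M ^ 2 := by
    intro s hs
    have hin : BddMeasurable fun x => ∫ j, tilt ρ Q t (x, j) * ρ x j ∂(Q : Measure (Fin k)) :=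
      hTr.integral_right _
    have hpt : ∀ x, Real.log (partitionFn ρ Q (t + s) x) - Real.log (partitionFn ρ Q t x)
        ≤ s * (∫ j, tilt ρ Q t (x, j) * ρ x j ∂(Q : Measure (Fin k))) + s ^ 2 * M ^ 2 := by
      intro x
      have hp := partitionFn_pos (Q := Q) hr t x
      have hp' := partitionFn_pos (Q := Q) hr (t + s) x
      have hratio : partitionFn ρ Q (t + s) x / partitionFn ρ Q t x
          = ∫ j, tilt ρ Q t (x, j) * Real.exp (s * ρ x j) ∂(Q : Measure (Fin k)) := by
        rw [partitionFn, ← integral_div]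
        refine integral_congr_ae (ae_of_all _ fun j => ?_)
        simp only [tilt]
        rw [add_mul, Real.exp_add]
        ring
      have hexp : ∀ j, Real.exp (s * ρ x j) ≤ 1 + s * ρ x j + s ^ 2 * M ^ 2 := by
        intro j
        have h0 : |s * ρ x j| ≤ |s| * M := by
          rw [abs_mul]
          exact mul_le_mul_of_nonneg_left (hM (x, j)) (abs_nonneg s)
        have h1 := (abs_le.1 (Real.abs_exp_sub_one_sub_id_le (h0.trans hs))).2
        have h2 : (s * ρ x j) ^ 2 ≤ s ^ 2 * M ^ 2 := by
          rw [← sq_abs, ← sq_abs s, ← mul_pow]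
          exact pow_le_pow_left₀ (abs_nonneg _) h0 2
        linarith
      have hlin : ∫ j, tilt ρ Q t (x, j) * Real.exp (s * ρ x j) ∂(Q : Measure (Fin k))
          ≤ 1 + s * (∫ j, tilt ρ Q t (x, j) * ρ x j ∂(Q : Measure (Fin k)))
            + s ^ 2 * M ^ 2 := by
        calc _ ≤ ∫ j, ((1 + s ^ 2 * M ^ 2) * tilt ρ Q t (x, j)
                + s * (tilt ρ Q t (x, j) * ρ x j)) ∂(Q : Measure (Fin k)) := by
              refine integral_mono .of_finite .of_finite fun j => ?_
              have := mul_le_mul_of_nonneg_left (hexp j) (tilt_pos (Q := Q) hr t (x, j)).le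
              simp only
              linarith
          _ = _ := by
              rw [integral_add .of_finite .of_finite, integral_const_mul, integral_const_mul,
                integral_tilt_right hr]
              ring
      rw [← Real.log_div hp'.ne' hp.ne']
      have := Real.log_le_sub_one_of_pos (div_pos hp' hp)
      rw [hratio] at this ⊢
      linarith
    have hl := (bddMeasurable_log_partitionFn (Q := Q) hr (t + s)).integrable P
    have hl' := (bddMeasurable_log_partitionFn (Q := Q) hr t).integrable P
    calc logMGF P ρ Q (t + s) - logMGF P ρ Q t
        = ∫ x, (Real.log (partitionFn ρ Q (t + s) x) - Real.log (partitionFn ρ Q t x)) ∂P :=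
          (integral_sub hl hl').symm
      _ ≤ ∫ x, (s * (∫ j, tilt ρ Q t (x, j) * ρ x j ∂(Q : Measure (Fin k)))
            + s ^ 2 * M ^ 2) ∂P :=
          integral_mono (hl.sub hl')
            ((((BddMeasurable.const s).mul hin).add (.const _)).integrable P) hpt
      _ = s * d + s ^ 2 * M ^ 2 := by
          rw [integral_add (((BddMeasurable.const s).mul hin).integrable P) (integrable_const _),
            integral_const_mul, hd, integral_prod _ (hTr.integrable _)]
          simp
  have hmin : IsLocalMin (fun s : ℝ => s * d + s ^ 2 * M ^ 2 - s * D) 0 := by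
    have h1 : ∀ᶠ s : ℝ in nhds 0, |s| * M < 1 := by
      have : ContinuousAt (fun s : ℝ => |s| * M) 0 := by fun_prop
      exact this.eventually_lt continuousAt_const (by simp)
    have h2 : ∀ᶠ s : ℝ in nhds 0, t + s < 0 := by
      have : ContinuousAt (fun s : ℝ => t + s) 0 := by fun_prop
      exact this.eventually_lt continuousAt_const (by simpa using ht)
    filter_upwards [h1, h2] with s hs hs'
    have := hupper s hs.le
    have := hmax (t + s) hs'.le
    simp only [zero_mul]
    nlinarith
  have hderiv : HasDerivAt (fun s : ℝ => s * d + s ^ 2 * M ^ 2 - s * D) (d - D) 0 := by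
    have := (((hasDerivAt_id (0 : ℝ)).mul_const d).add
      (((hasDerivAt_id (0 : ℝ)).pow 2).mul_const (M ^ 2))).sub ((hasDerivAt_id (0 : ℝ)).mul_const D)
    exact this.congr_deriv (by simp)
  exact sub_eq_zero.1 (hmin.hasDerivAt_eq_zero hderiv)

end Tilt

/-- Where `f` vanishes, the partition function is pinned to the same constant. -/
theorem log_partitionFn_of_redundancyFn_eq_zero {k : ℕ} {P : Measure ℝ}
    {ρ : ℝ → Fin k → ℝ} {Q : ProbabilityMeasure (Fin k)} {D t x : ℝ}
    (h : redundancyFn P ρ D Q t x = 0) :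
    Real.log (partitionFn ρ Q t x) = t * D - rateDistortion P ρ D * Real.log 2 := by
  have hlog2 : 0 < Real.log 2 := Real.log_pos one_lt_two
  simp only [redundancyFn, Real.logb, Real.log_exp] at h
  change 1 / Real.log 2 * (t * D - Real.log (partitionFn ρ Q t x)) - _ = 0 at h
  field_simp at h
  linarith

/-! ### The tilting parameter is the slope of the rate-distortion function -/

/-- If `f` vanishes almost surely, so that `E_Q[exp (lam ρ(X, Y))]` is almost surely constant, then
`lam` is the slope at `D` of the rate-distortion function in nats. The tilted test channel attains
`R(D)`, and its perturbations by the factor `1 + t h`, where `h` is the centred distortion and `V`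
its variance, have distortion `D + t V` and rate at most `R(D) log 2 + lam t V + t² V`. Hence `R` is
touched from above at `D` by a parabola of slope `lam`. Below `D_max` the variance `V` is
positive. -/
theorem deriv_mul_log_two_eq {k : ℕ} {P : Measure ℝ} [IsProbabilityMeasure P]
    {ρ : ℝ → Fin k → ℝ} (hr : BddMeasurable fun z : ℝ × Fin k => ρ z.1 z.2)
    {Q : ProbabilityMeasure (Fin k)} {D lam r : ℝ} (hDmax : D < distMax P ρ)
    (hopt : IsOptimalPair P ρ D Q lam) (hf : ∀ᵐ x ∂P, redundancyFn P ρ D Q lam x = 0)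
    (hR : HasDerivAt (rateDistortion P ρ) r D) : r * Real.log 2 = lam := by
  have hmax : ∀ s ≤ 0, s * D - logMGF P ρ Q s ≤ lam * D - logMGF P ρ Q lam := fun s hs => by
    rw [← EReal.coe_le_coe_iff, hopt.attains]
    exact le_iSup₂_of_le s hs le_rfl
  set κ := lam * D - rateDistortion P ρ D * Real.log 2 with hκ
  have hlogc : ∀ᵐ x ∂P, Real.log (partitionFn ρ Q lam x) = κ := by
    filter_upwards [hf] with x hx
    exact log_partitionFn_of_redundancyFn_eq_zero hx
  set μ := P.prod (Q : Measure (Fin k)) with hμ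
  have hT := bddMeasurable_tilt (Q := Q) hr lam
  have hTpos := tilt_pos (Q := Q) hr lam
  have hmean : ∫ z, tilt ρ Q lam z * ρ z.1 z.2 ∂μ = D := integral_tilt_mul_eq hr hopt.neg hmax
  -- the conditional mean of the distortion, and the centred distortion
  set m : ℝ → ℝ := fun x => ∫ j, tilt ρ Q lam (x, j) * ρ x j ∂(Q : Measure (Fin k)) with hm
  have hmB : BddMeasurable m := (hT.mul hr).integral_right _
  set h : ℝ × Fin k → ℝ := fun z => ρ z.1 z.2 - m z.1 with hh
  have hhB : BddMeasurable h := hr.sub (hmB.comp measurable_fst)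
  have hcent : ∀ x, ∫ j, tilt ρ Q lam (x, j) * h (x, j) ∂(Q : Measure (Fin k)) = 0 := fun x => by
    simp only [hh, mul_sub]
    rw [integral_sub .of_finite .of_finite, integral_mul_const, integral_tilt_right hr, one_mul]
    exact sub_self _
  -- expectation under the tilted channel
  set E : (ℝ × Fin k → ℝ) → ℝ := fun f => ∫ z, tilt ρ Q lam z * f z ∂μ with hE
  have hEadd : ∀ f g, BddMeasurable f → BddMeasurable g →
      E (fun z => f z + g z) = E f + E g := fun f g hf hg => by
    simp only [hE, mul_add]
    exact integral_add ((hT.mul hf).integrable μ) ((hT.mul hg).integrable μ)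
  have hEmul : ∀ c f, E (fun z => c * f z) = c * E f := fun c f => by
    simp only [hE, mul_left_comm _ c]
    exact integral_const_mul c _
  have hE1 : E (fun _ => 1) = 1 := by
    simp only [hE, mul_one]
    rw [hμ, integral_prod _ (hT.integrable _)]
    simp [integral_tilt_right hr]
  have hEh : ∀ ψ : ℝ → ℝ, BddMeasurable ψ → E (fun z => ψ z.1 * h z) = 0 := fun ψ hψ => by
    simp only [hE, mul_left_comm _ (ψ _)]
    rw [hμ, integral_prod _ (((hψ.comp measurable_fst).mul (hT.mul hhB)).integrable _)]
    simp [integral_const_mul, hcent]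
  have hEh0 : E h = 0 := by simpa using hEh _ (.const 1)
  set V := E (fun z => h z * h z) with hV
  have hEρ : E (fun z => ρ z.1 z.2) = D := hmean
  have hEhρ : E (fun z => h z * ρ z.1 z.2) = V := by
    have : (fun z => h z * ρ z.1 z.2) = fun z => h z * h z + m z.1 * h z := by
      funext z
      simp only [hh]
      ring
    rw [this, hEadd _ _ (hhB.mul hhB) ((hmB.comp measurable_fst).mul hhB), hEh m hmB, add_zero]
  have hVpos : 0 < V := by
    have hnn : 0 ≤ fun z => tilt ρ Q lam z * (h z * h z) :=
      fun z => mul_nonneg (hTpos z).le (mul_self_nonneg _)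
    refine lt_of_le_of_ne (integral_nonneg hnn) fun hV0 => ?_
    -- If the variance vanishes, a letter `j` charged by `Q` has expected distortion `D`.
    have hzero : ∀ᵐ z ∂μ, h z = 0 := by
      have := (integral_eq_zero_iff_of_nonneg hnn
        ((hT.mul (hhB.mul hhB)).integrable μ)).1 hV0.symm
      filter_upwards [this] with z hz
      simpa [(hTpos z).ne'] using hz
    have hQ : ∃ j, (Q : Measure (Fin k)) {j} ≠ 0 := by
      by_contra! hcon
      have hz : ∀ j, (Q : Measure (Fin k)).real {j} = 0 := fun j => by
        simp [measureReal_def, hcon j]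
      have hs : ∑ j, (Q : Measure (Fin k)).real {j} = 1 := by
        rw [sum_measureReal_singleton]
        simp
      simp [hz] at hs
    obtain ⟨j, hj⟩ := hQ
    have hae : ∀ᵐ x ∂P, ρ x j = m x := by
      filter_upwards [Measure.ae_ae_of_ae_prod hzero] with x hx
      exact sub_eq_zero.1 (ae_iff_of_countable.1 hx j hj)
    have hle : distMax P ρ ≤ ∫ x, ρ x j ∂P := ciInf_le (Set.finite_range _).bddBelow j
    rw [integral_congr_ae hae, ← integral_prod _ ((hT.mul hr).integrable _), ← hμ, hmean] at hle
    exact absurd hDmax (not_lt.2 hle)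
  obtain ⟨B, hB⟩ := hhB.2
  obtain ⟨a, ha, haT⟩ := exists_le_tilt (Q := Q) hr lam
  obtain ⟨C, hC⟩ := hT.2
  have hupper : ∀ t : ℝ, |t| * B ≤ 1 / 2 →
      rateDistortion P ρ (D + t * V) * Real.log 2 ≤ lam * (D + t * V) - κ + t ^ 2 * V := by
    intro t ht
    have hth : ∀ z, |t * h z| ≤ 1 / 2 := fun z => by
      rw [abs_mul]
      exact (mul_le_mul_of_nonneg_left (hB z) (abs_nonneg t)).trans ht
    have hfac : ∀ z, 1 / 2 ≤ 1 + t * h z ∧ 1 + t * h z ≤ 2 := fun z => by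
      have := abs_le.1 (hth z)
      constructor <;> linarith
    have hthB : BddMeasurable fun z => t * h z := (BddMeasurable.const t).mul hhB
    have hwB : BddMeasurable fun z => tilt ρ Q lam z * (1 + t * h z) :=
      hT.mul ((BddMeasurable.const 1).add hthB)
    have hwb : ∀ z, tilt ρ Q lam z * (1 + t * h z) ∈ Set.Icc (a * (1 / 2)) (C * 2) := fun z =>
      ⟨mul_le_mul (haT z) (hfac z).1 (by norm_num) (hTpos z).le,
        mul_le_mul ((le_abs_self _).trans (hC z)) (hfac z).2 (by linarith [(hfac z).1])
          ((abs_nonneg _).trans (hC z))⟩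
    have hnorm : ∀ x, ∫ j, tilt ρ Q lam (x, j) * (1 + t * h (x, j)) ∂(Q : Measure (Fin k)) = 1 := by
      intro x
      simp only [mul_add, mul_one, mul_left_comm _ t]
      rw [integral_add .of_finite .of_finite, integral_const_mul, hcent, integral_tilt_right hr]
      simp
    have hdist : ∫ z, tilt ρ Q lam z * (1 + t * h z) * ρ z.1 z.2 ∂μ = D + t * V := by
      have : E (fun z => ρ z.1 z.2 + t * (h z * ρ z.1 z.2)) = D + t * V := by
        rw [hEadd _ _ hr ((BddMeasurable.const t).mul (hhB.mul hr)), hEmul, hEρ, hEhρ]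
      rw [← this]
      exact integral_congr_ae (ae_of_all _ fun z => by simp only; ring)
    refine (rateDistortion_mul_log_two_le hwB.1 (by positivity) hwb hnorm hdist.le).trans ?_
    have hκB : BddMeasurable fun z : ℝ × Fin k => lam * ρ z.1 z.2 + -κ * 1 :=
      ((BddMeasurable.const lam).mul hr).add ((BddMeasurable.const (-κ)).mul (.const 1))
    -- `w log w ≤ w (lam ρ - κ + t h)` almost everywhere, from `log (1 + t h) ≤ t h`
    have hpt : ∀ᵐ z ∂μ, tilt ρ Q lam z * (1 + t * h z)
          * Real.log (tilt ρ Q lam z * (1 + t * h z))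
        ≤ tilt ρ Q lam z * (1 + t * h z) * ((lam * ρ z.1 z.2 + -κ * 1) + t * h z) := by
      have hfst : ∀ᵐ z ∂μ, Real.log (partitionFn ρ Q lam z.1) = κ :=
        Measure.quasiMeasurePreserving_fst.ae hlogc
      filter_upwards [hfst] with z hz
      have h1 : 0 < 1 + t * h z := by linarith [(hfac z).1]
      refine mul_le_mul_of_nonneg_left ?_ (mul_pos (hTpos z) h1).le
      rw [Real.log_mul (hTpos z).ne' h1.ne', tilt_eq_exp hr, Real.log_exp, hz]
      linarith [Real.log_le_sub_one_of_pos h1]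
    calc _ ≤ ∫ z, tilt ρ Q lam z * (1 + t * h z)
            * ((lam * ρ z.1 z.2 + -κ * 1) + t * h z) ∂μ :=
          integral_mono_ae ((hwB.mul (.log hwB.1 (by positivity) hwb)).integrable μ)
            ((hwB.mul (hκB.add hthB)).integrable μ) hpt
      _ = E fun z => (lam * (ρ z.1 z.2 + t * (h z * ρ z.1 z.2)) + -κ * (1 + t * h z))
            + (t * h z + t ^ 2 * (h z * h z)) :=
          integral_congr_ae (ae_of_all _ fun z => by simp only; ring)
      _ = lam * (D + t * V) - κ + t ^ 2 * V := by
          have c := fun s => BddMeasurable.const (α := ℝ × Fin k) s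
          rw [hEadd _ _ (((c lam).mul (hr.add ((c t).mul (hhB.mul hr)))).add
              ((c (-κ)).mul ((c 1).add hthB))) (hthB.add ((c (t ^ 2)).mul (hhB.mul hhB))),
            hEadd _ _ ((c lam).mul (hr.add ((c t).mul (hhB.mul hr))))
              ((c (-κ)).mul ((c 1).add hthB)),
            hEadd _ _ hthB ((c (t ^ 2)).mul (hhB.mul hhB)),
            hEmul lam, hEmul (-κ), hEadd _ _ hr ((c t).mul (hhB.mul hr)),
            hEadd _ _ (c 1) hthB, hEmul t, hEmul t, hEmul (t ^ 2), hEρ, hEhρ, hE1, hEh0]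
          ring
  have hmin : IsLocalMin
      (fun t : ℝ => lam * (D + t * V) - κ + t ^ 2 * V
        - rateDistortion P ρ (D + t * V) * Real.log 2) 0 := by
    have h1 : ∀ᶠ t : ℝ in nhds 0, |t| * B < 1 / 2 := by
      have : ContinuousAt (fun s : ℝ => |s| * B) 0 := by fun_prop
      exact this.eventually_lt continuousAt_const (by simp)
    filter_upwards [h1] with t ht
    have := hupper t ht.le
    simp only [zero_mul, add_zero, ne_eq, OfNat.ofNat_ne_zero, not_false_eq_true, zero_pow, hκ]
      at this ⊢
    linarith
  have hline : HasDerivAt (fun t : ℝ => D + t * V) V 0 := by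
    simpa using ((hasDerivAt_id (0 : ℝ)).mul_const V).const_add D
  have hcomp : HasDerivAt (fun t : ℝ => rateDistortion P ρ (D + t * V)) (r * V) 0 := by
    refine HasDerivAt.comp (h₂ := rateDistortion P ρ) 0 ?_ hline
    simpa using hR
  have hderiv := ((((hline.const_mul lam).sub_const κ).add
    (((hasDerivAt_id (0 : ℝ)).pow 2).mul_const V)).sub (hcomp.mul_const (Real.log 2)))
  have h0 := hmin.hasDerivAt_eq_zero hderiv
  simp only [id_eq, Nat.cast_ofNat, mul_one] at h0
  have : V * (lam - r * Real.log 2) = 0 := by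
    rw [← h0]
    ring
  exact (sub_eq_zero.1 ((mul_eq_zero.1 this).resolve_left hVpos.ne')).symm

end LossyRedundancy

/-! ### Finiteness of the exceptional distortion levels -/

open LossyRedundancy in
theorem corollary2 {k : ℕ} (hk : 0 < k)
    (P : MeasureTheory.Measure ℝ) [MeasureTheory.IsProbabilityMeasure P]
    (ρ : ℝ → Fin k → ℝ) (M : ℝ)
    (hρ_meas : ∀ j, Measurable (fun x => ρ x j))
    (hρ_bdd : ∀ x j, ρ x j ∈ Set.Icc 0 M)
    (hρ_zero : ⨆ x, ⨅ j, ρ x j = 0)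
    (I : Set ℝ) (hI_open : IsOpen I) (hI_conn : I.OrdConnected) (hI_ne : I.Nonempty)
    (hP : LossyRedundancy.HasPositiveDensityOn P I)
    (hρ_cont : ∀ j, ContinuousOn (fun x => ρ x j) I)
    (hR_diff : DifferentiableOn ℝ (LossyRedundancy.rateDistortion P ρ)
      (Set.Ioo 0 (LossyRedundancy.distMax P ρ)))
    (hR_conv : StrictConvexOn ℝ (Set.Ioo 0 (LossyRedundancy.distMax P ρ))
      (LossyRedundancy.rateDistortion P ρ))
    (hcond : LossyRedundancy.ConditionA ρ I ∨ LossyRedundancy.ConditionB ρ I) :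
    {D : ℝ | D ∈ Set.Ioo 0 (LossyRedundancy.distMax P ρ) ∧
      ∃ (Q : MeasureTheory.ProbabilityMeasure (Fin k)) (lam : ℝ),
        LossyRedundancy.IsOptimalPair P ρ D Q lam ∧
          ∀ᵐ x ∂P, LossyRedundancy.redundancyFn P ρ D Q lam x = 0}.Finite := by
  obtain ⟨x, -, hxI, hx⟩ := hcond.elim ConditionA.conditionB id
  have hr : BddMeasurable fun z : ℝ × Fin k => ρ z.1 z.2 :=
    .of_mem_Icc (measurable_from_prod_countable_left hρ_meas) fun z => hρ_bdd z.1 z.2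
  have hdiff : ∀ D ∈ Set.Ioo 0 (distMax P ρ), DifferentiableAt ℝ (rateDistortion P ρ) D :=
    fun D hD => (hR_diff D hD).differentiableAt (isOpen_Ioo.mem_nhds hD)
  have hinj := (hR_conv.strictMonoOn_deriv hdiff).injOn
  -- `D ↦ R'(D) log 2` maps the exceptional distortion levels injectively into the zeros.
  refine Set.Finite.of_injOn (f := fun D => deriv (rateDistortion P ρ) D * Real.log 2)
    ?_ ?_ (finite_zeros_det_exp hx)
  · rintro D ⟨hD, Q, lam, hopt, hf⟩
    have hslope := deriv_mul_log_two_eq hr hD.2 hopt hf (hdiff D hD).hasDerivAt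
    simp only [hslope]
    have hconst : ∀ᵐ y ∂volume.restrict I, partitionFn ρ Q lam y
        = Real.exp (lam * D - rateDistortion P ρ D * Real.log 2) := by
      refine hP.ae_volume hI_open.measurableSet ?_
      filter_upwards [hf] with y hy
      rw [← log_partitionFn_of_redundancyFn_eq_zero hy, Real.exp_log (partitionFn_pos hr lam y)]
    have hcont : ContinuousOn (partitionFn ρ Q lam) I := by
      have : partitionFn ρ Q lam
          = fun y => ∑ j, (Q : Measure (Fin k)).real {j} * Real.exp (lam * ρ y j) := by
        funext y
        rw [partitionFn, integral_fintype .of_finite]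
        simp only [smul_eq_mul]
      rw [this]
      exact continuousOn_finsetSum _ fun j _ =>
        continuousOn_const.mul (Real.continuous_exp.comp_continuousOn
          (continuousOn_const.mul (hρ_cont j)))
    have heq := Measure.eqOn_open_of_ae_eq hconst hI_open hcont continuousOn_const
    exact det_exp_eq_zero Q fun i => heq (hxI i)
  · intro D hD D' hD' h
    exact hinj hD.1 hD'.1 (mul_right_cancel₀ (Real.log_pos one_lt_two).ne' h)
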